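/- Write $\delta=z\frac{d}{dz}$ and $\mathrm{Li}_2(z)=\sum_{k\ge1}z^k/k^2\in\mathbb{Q}[[z]]$. A formal power series $W\in\mathbb{Q}[[z]]$ is called a 2-function if $W(z)=\sum_{d\ge1}n_d\,\mathrm{Li}_2(z^d)$ with integers $n_d$. Let $W$ be a 2-function and put $Y(z)=\exp(-\delta W(z))$. Define the framed image $\tilde W(\tilde z)\in\mathbb{Q}[[\tilde z]]$ of $W$ as follows: invert the relation $\tilde z=-zY(z)$ as formal power series and write the inverse as $z=-\tilde z\,\tilde Y(\tilde z)$, where $\tilde Y$ has constant term $1$; then let $\tilde W$ be the power series without constant term such that $\tilde z\frac{d}{d\tilde z}\tilde W=-\log\tilde Y$. Then $\tilde W$ exists and is unique, and it is again a 2-function; equivalently, the rational numbers $\tilde n_d$ ($d\ge1$) determined by $\tilde W(\tilde z)=\sum_{d\ge1}\tilde n_d\,\mathrm{Li}_2(\tilde z^d)$ are all integers. -/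

import Mathlib

namespace Framing

noncomputable section

open PowerSeries

/-- The logarithmic derivative operator `δ = z d/dz` on formal power series. -/
def delta (F : PowerSeries ℚ) : PowerSeries ℚ :=
  X * derivative ℚ F

/-- The dilogarithm `Li₂(z) = ∑_{k ≥ 1} z^k / k^2` as a formal power series
(the constant term is `0` because `1 / 0 ^ 2 = 0` in `ℚ`). -/
def li2 : PowerSeries ℚ :=
  mk fun k => 1 / (k : ℚ) ^ 2

/-- The formal sum `∑_{d ≥ 1} n_d Li₂(z^d)`. As `Li₂(z^d)` has order `d`, only the terms with
`1 ≤ d ≤ k` contribute to the coefficient of `z^k`. The value `n 0` is not used. -/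
def dilogSum (n : ℕ → ℚ) : PowerSeries ℚ :=
  mk fun k => ∑ d ∈ Finset.Icc 1 k, n d * coeff k (li2.subst (X ^ d : PowerSeries ℚ))

/-- `W` is a 2-function: an integral linear combination of dilogarithms `Li₂(z^d)`, `d ≥ 1`. -/
def IsTwoFunction (W : PowerSeries ℚ) : Prop :=
  ∃ n : ℕ → ℤ, W = dilogSum fun d => (n d : ℚ)

/-- `Y = exp (-δ W)`; the series `-δ W` has constant term `0`. -/
def expNegDelta (W : PowerSeries ℚ) : PowerSeries ℚ :=
  (exp ℚ).subst (-delta W)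

/-- The formal power series `F` and `G` without constant term are compositional inverses
of each other: `w = F(z)` if and only if `z = G(w)`. -/
def AreCompInverse (F G : PowerSeries ℚ) : Prop :=
  constantCoeff F = 0 ∧ constantCoeff G = 0 ∧
    F.subst G = (X : PowerSeries ℚ) ∧ G.subst F = (X : PowerSeries ℚ)

/-- `W'` is the image of `W` under framing: with `Y = exp (-δ W)`, the relation `w = -z Y(z)` is
inverted as `z = -w Y'(w)`, where `Y'` has constant term `1`, and `W'` is the series without
constant term with `δ W' = -log Y'`. -/
def IsFramedImage (W W' : PowerSeries ℚ) : Prop :=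
  ∃ Y' : PowerSeries ℚ, constantCoeff Y' = 1 ∧
    AreCompInverse (-(X * expNegDelta W)) (-(X * Y')) ∧
    constantCoeff W' = 0 ∧ delta W' = -logOf Y'

end

end Framing

open PowerSeries

namespace Framing

/-! Put φ = 1/Y = exp(δW). Formally φ = ∏ (1 - z^d)^(-d n_d), and δ log φ has coefficients a_k =
∑_{d ∣ k} d² n_d. Lagrange inversion gives k² [z^k] W̃ = g_k with g_k = -(-1)^k [z^k] φ^k
(`coeff_delta_logOf_of_inverse`, `IsFramedImage.sq_mul_coeff`). By Möbius inversion, W̃ is a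
2-function once g_k ≡ g_{k/p} modulo p^(2 v_p(k)) whenever p ∣ k (`sq_dvd_of_gauss`,
`exists_dilogSum_of_gauss`). The sequence a satisfies these congruences
(`pow_dvd_sum_divisors_sub`), and the task is to transfer them to g.

For n = pm write φ(z)^n = exp(nL) φ(z^p)^m with L = (1/p) log(φ(z)^p / φ(z^p)); the congruences for
a make L p-integral. Expand the exponential and take [z^n]. The term j = 0 is [z^m] φ^m. The term j
= 1 has a factor n, and its other factor is again divisible by p^(v_p(n)). For j ≥ 2 the factor n^j
/ j! suffices, except when p = 2: for m even only j = 2 falls short, by one factor 2, which the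
coefficient supplies (`PDvd.coeff_pow_sub_coeff_pow`).

There remains p = 2 with m odd, the only case where the sign (-1)^k matters. The modulus is then 4,
and the congruence follows from a property of φ stable under products and inverses, checked on the
factors 1 - z^d (`evenSquareSubgroup`). -/

/-! ### Divisibility by prime powers in the p-integral rationals. -/

/-- `p ^ r` divides the rational number `q` in the `p`-integral rational numbers. -/
def PDvd (p r : ℕ) (q : ℚ) : Prop :=
  padicNorm p q ≤ (p : ℚ) ^ (-(r : ℤ))

namespace PDvd

variable {p r s : ℕ} {x y : ℚ}

theorem zero : PDvd p r 0 := by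
  simp only [PDvd, padicNorm.zero]
  positivity

variable [hp : Fact p.Prime]

theorem add (hx : PDvd p r x) (hy : PDvd p r y) : PDvd p r (x + y) :=
  padicNorm.nonarchimedean.trans (max_le hx hy)

theorem sub (hx : PDvd p r x) (hy : PDvd p r y) : PDvd p r (x - y) :=
  padicNorm.sub.trans (max_le hx hy)

theorem mul (hx : PDvd p r x) (hy : PDvd p s y) : PDvd p (r + s) (x * y) := by
  have h0 : (p : ℚ) ≠ 0 := by exact_mod_cast hp.out.ne_zero
  simp only [PDvd, padicNorm.mul, Nat.cast_add, neg_add, zpow_add₀ h0]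
  exact mul_le_mul hx hy (padicNorm.nonneg _) (by positivity)

theorem mono (h : s ≤ r) (hx : PDvd p r x) : PDvd p s x := by
  refine le_trans hx (zpow_le_zpow_right₀ ?_ (by omega))
  exact_mod_cast hp.out.one_lt.le

theorem intCast_iff {z : ℤ} : PDvd p r z ↔ (p : ℤ) ^ r ∣ z := by
  rw [PDvd, ← padicNorm.dvd_iff_norm_le]
  push_cast
  rfl

theorem intCast (z : ℤ) : PDvd p 0 z :=
  intCast_iff.2 (by simp)

theorem sum {ι : Type*} {t : Finset ι} {F : ι → ℚ} (h : ∀ i ∈ t, PDvd p r (F i)) :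
    PDvd p r (∑ i ∈ t, F i) :=
  padicNorm.sum_le' h (by positivity)

theorem natCast {k : ℕ} (h : r ≤ padicValNat p k) : PDvd p r (k : ℚ) := by
  have : (p : ℤ) ^ r ∣ (k : ℤ) := by
    exact_mod_cast (pow_dvd_pow p h).trans pow_padicValNat_dvd
  exact_mod_cast intCast_iff.2 this

theorem div_natCast {k : ℕ} (hk : k ≠ 0) (hx : PDvd p s x) (h : r + padicValNat p k ≤ s) :
    PDvd p r (x / k) := by
  have h0 : (p : ℚ) ≠ 0 := by exact_mod_cast hp.out.ne_zero
  have hk' : padicNorm p k = (p : ℚ) ^ (-(padicValNat p k : ℤ)) := by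
    rw [padicNorm.eq_zpow_of_nonzero (by exact_mod_cast hk), padicValRat.of_nat]
  have hx' := hx.mono h
  rw [PDvd, padicNorm.div, hk', div_le_iff₀ (by have := hp.out.pos; positivity),
    ← zpow_add₀ h0]
  refine le_trans hx' (le_of_eq ?_)
  congr 1
  push_cast
  ring

theorem mul_left (hx : PDvd p r x) (hy : PDvd p 0 y) : PDvd p r (x * y) :=
  hx.mul hy

theorem mul_right (hx : PDvd p 0 x) (hy : PDvd p r y) : PDvd p r (x * y) := by
  rw [mul_comm]
  exact hy.mul hx

theorem powerSeries_mul {F G : PowerSeries ℚ} (hF : ∀ k, PDvd p 0 (coeff k F))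
    (hG : ∀ k, PDvd p 0 (coeff k G)) (k : ℕ) : PDvd p 0 (coeff k (F * G)) := by
  rw [coeff_mul]
  exact sum fun i _ => (hF i.1).mul (hG i.2)

theorem powerSeries_pow {F : PowerSeries ℚ} (hF : ∀ k, PDvd p 0 (coeff k F)) (j k : ℕ) :
    PDvd p 0 (coeff k (F ^ j)) := by
  induction j generalizing k with
  | zero =>
    rw [pow_zero, coeff_one]
    split_ifs
    · exact_mod_cast intCast 1
    · exact zero
  | succ j ih => rw [pow_succ]; exact powerSeries_mul ih hF k

/-- The valuation of `n ^ j / j!` is at least twice the valuation of `n`, for `j ≥ 2`, with some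
exceptions at the prime `2`. -/
theorem pow_div_factorial {n j : ℕ} (hn : p ∣ n) (hn0 : n ≠ 0) (hj : 2 ≤ j)
    (h : p ≠ 2 ∨ (3 ≤ j ∧ 2 ≤ padicValNat p n)) :
    PDvd p (2 * padicValNat p n) ((n : ℚ) ^ j / (j.factorial : ℚ)) := by
  have hr : 1 ≤ padicValNat p n := one_le_padicValNat_of_dvd hn0 hn
  -- With j = 2 + i, the spare i · v_p(n) must absorb v_p(j!). Legendre's bound (p - 1) v_p(j!) < j
  -- gives v_p(j!) ≤ (i + 1)/2 for odd p and v_p(j!) ≤ i + 1 for p = 2; in the latter case i ≥ 1 and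
  -- v_p(n) ≥ 2.
  have key : 2 * padicValNat p n + padicValNat p j.factorial ≤ j * padicValNat p n := by
    have hlt := sub_one_mul_padicValNat_factorial_lt_of_ne_zero (p := p) (n := j) (by omega)
    obtain ⟨i, rfl⟩ := Nat.exists_eq_add_of_le hj
    rw [add_mul]
    refine Nat.add_le_add_left ?_ _
    rcases h with h | ⟨h3, h2⟩
    · have hp3 : 2 ≤ p - 1 := by have := hp.out.two_le; omega
      have : 2 * padicValNat p (2 + i).factorial ≤ (p - 1) * padicValNat p (2 + i).factorial :=
        Nat.mul_le_mul_right _ hp3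
      have : i * 1 ≤ i * padicValNat p n := Nat.mul_le_mul_left _ hr
      omega
    · have hp3 : 1 ≤ p - 1 := by have := hp.out.two_le; omega
      have : 1 * padicValNat p (2 + i).factorial ≤ (p - 1) * padicValNat p (2 + i).factorial :=
        Nat.mul_le_mul_right _ hp3
      have : i * 2 ≤ i * padicValNat p n := Nat.mul_le_mul_left _ h2
      omega
  refine div_natCast (s := j * padicValNat p n) (Nat.factorial_ne_zero j) ?_ key
  have := natCast (p := p) (k := n ^ j) (r := j * padicValNat p n)
    (by rw [padicValNat.pow _ ])
  exact_mod_cast this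

end PDvd

/-! ### Calculus of the operator δ. -/

theorem coeff_delta (F : PowerSeries ℚ) (k : ℕ) : coeff k (delta F) = k * coeff k F := by
  cases k with
  | zero => simp [delta]
  | succ k => rw [delta, coeff_succ_X_mul, coeff_derivative]; push_cast; ring

theorem delta_add (F G : PowerSeries ℚ) : delta (F + G) = delta F + delta G := by
  simp [delta, mul_add]

theorem delta_neg (F : PowerSeries ℚ) : delta (-F) = -delta F := by
  simp [delta]

theorem delta_one : delta 1 = 0 := by
  simp [delta]

theorem delta_X : delta X = X := by
  simp [delta]

theorem delta_mul (F G : PowerSeries ℚ) : delta (F * G) = F * delta G + delta F * G := by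
  simp only [delta, Derivation.leibniz, smul_eq_mul]
  ring

theorem delta_pow {F C : PowerSeries ℚ} (h : delta F = F * C) (n : ℕ) :
    delta (F ^ n) = F ^ n * (n * C) := by
  induction n with
  | zero => simp [delta_one]
  | succ n ih => rw [pow_succ, delta_mul, ih, h]; push_cast; ring

theorem delta_subst {F G : PowerSeries ℚ} (hG : constantCoeff G = 0) :
    delta (F.subst G) * G = (delta F).subst G * delta G := by
  have hs : HasSubst G := .of_constantCoeff_zero' hG
  simp only [delta]
  rw [derivative_subst hs, subst_mul hs, subst_X hs]
  ring

theorem delta_exp_subst {E : PowerSeries ℚ} (hE : constantCoeff E = 0) :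
    delta ((exp ℚ).subst E) = (exp ℚ).subst E * delta E := by
  have hs : HasSubst E := .of_constantCoeff_zero' hE
  simp only [delta]
  rw [derivative_subst hs, derivative_exp]
  ring

theorem constantCoeff_exp_subst {E : PowerSeries ℚ} (hE : constantCoeff E = 0) :
    constantCoeff ((exp ℚ).subst E) = 1 := by
  have h : exp ℚ = (exp ℚ - 1) + 1 := by ring
  have hs : HasSubst E := .of_constantCoeff_zero' hE
  rw [h, subst_add hs, map_add, ← coe_substAlgHom hs, map_one, map_one, coe_substAlgHom hs]
  have := constantCoeff_subst_eq_zero (a := E) hE (exp ℚ - 1) (by simp)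
  rw [constantCoeff_eq, this, zero_add]

theorem delta_logOf {F : PowerSeries ℚ} (hF : constantCoeff F = 1) :
    delta (logOf F) * F = delta F := by
  have hs : HasSubst (F - 1) := .of_constantCoeff_zero' (by simp [hF])
  have h1 : d⁄dX ℚ (log ℚ) * (1 + X) = 1 := by
    rw [deriv_log]
    ext n
    cases n with
    | zero => simp
    | succ n => rw [mul_add, mul_one, map_add, coeff_succ_mul_X]; simp [pow_succ, coeff_one]
  have h2 : (d⁄dX ℚ (log ℚ)).subst (F - 1) * F = 1 := by
    have := congrArg (substAlgHom hs) h1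
    rw [map_mul, map_add, map_one, coe_substAlgHom, subst_X hs] at this
    simpa using this
  simp only [delta]
  rw [logOf_eq, derivative_subst hs, map_sub, derivative_one, sub_zero]
  linear_combination (X * d⁄dX ℚ F) * h2

theorem delta_expand {p : ℕ} (hp : p ≠ 0) (F : PowerSeries ℚ) :
    delta (expand p hp F) = p * expand p hp (delta F) := by
  ext k
  rw [coeff_delta, ← map_natCast (C (R := ℚ)), coeff_C_mul, coeff_expand, coeff_expand]
  split_ifs with h
  · obtain ⟨m, rfl⟩ := h
    rw [Nat.mul_div_cancel_left _ (Nat.pos_of_ne_zero hp), coeff_delta]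
    push_cast
    ring
  · simp

/-- A power series is determined up to order `N` by its constant coefficient and its logarithmic
derivative up to order `N`. -/
theorem coeff_eq_of_delta_eq {F G A B : PowerSeries ℚ} {N : ℕ} (hF : delta F = F * A)
    (hG : delta G = G * B) (h0 : constantCoeff F = constantCoeff G)
    (hA : constantCoeff A = 0) (hB : constantCoeff B = 0)
    (hAB : ∀ k ≤ N, coeff k A = coeff k B) : ∀ k ≤ N, coeff k F = coeff k G := by
  intro k
  induction k using Nat.strong_induction_on with
  | _ k ih =>
    intro hk
    rcases Nat.eq_zero_or_pos k with rfl | hpos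
    · simpa using h0
    · have hk0 : (k : ℚ) ≠ 0 := by exact_mod_cast hpos.ne'
      refine mul_left_cancel₀ hk0 ?_
      rw [← coeff_delta, ← coeff_delta, hF, hG, coeff_mul, coeff_mul]
      refine Finset.sum_congr rfl fun x hx => ?_
      have hx' := Finset.HasAntidiagonal.mem_antidiagonal.1 hx
      rcases Nat.eq_zero_or_pos x.2 with h2 | h2
      · simp [h2, hA, hB]
      · rw [ih x.1 (by omega) (by omega), hAB x.2 (by omega)]

theorem eq_of_delta_eq {F G A : PowerSeries ℚ} (hF : delta F = F * A)
    (hG : delta G = G * A) (h0 : constantCoeff F = constantCoeff G)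
    (hA : constantCoeff A = 0) : F = G := by
  ext k
  exact coeff_eq_of_delta_eq hF hG h0 hA hA (fun _ _ => rfl) k le_rfl

theorem delta_injective {F G : PowerSeries ℚ} (h : delta F = delta G)
    (h0 : constantCoeff F = constantCoeff G) : F = G := by
  ext k
  rcases Nat.eq_zero_or_pos k with rfl | hpos
  · simpa using h0
  · have hk0 : (k : ℚ) ≠ 0 := by exact_mod_cast hpos.ne'
    refine mul_left_cancel₀ hk0 ?_
    rw [← coeff_delta, ← coeff_delta, h]

/-- Since G has no constant term, the powers G^j with j > n cannot reach order n, so the composition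
may be truncated. Used both to expand the exponential and for Lagrange inversion. -/
theorem coeff_subst_mul {F G : PowerSeries ℚ} (H : PowerSeries ℚ) (hG : constantCoeff G = 0)
    (n : ℕ) : coeff n (F.subst G * H) =
      ∑ j ∈ Finset.range (n + 1), coeff j F * coeff n (G ^ j * H) := by
  have hs : HasSubst G := .of_constantCoeff_zero' hG
  have key : ∀ m ≤ n, coeff m (F.subst G) =
      ∑ j ∈ Finset.range (n + 1), coeff j F * coeff m (G ^ j) := by
    intro m hm
    rw [coeff_subst' hs]
    rw [finsum_eq_sum_of_support_subset _ (s := Finset.range (n + 1))]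
    · simp
    · intro j hj
      by_contra hj'
      simp only [Finset.coe_range, Set.mem_Iio, not_lt] at hj'
      refine hj ?_
      have : coeff m (G ^ j) = 0 := by
        refine coeff_of_lt_order _ (lt_of_lt_of_le ?_ (le_order_pow_of_constantCoeff_eq_zero j hG))
        exact_mod_cast (by omega : m < j)
      simp [this]
  rw [coeff_mul]
  simp_rw [coeff_mul, Finset.mul_sum]
  rw [Finset.sum_comm]
  refine Finset.sum_congr rfl fun x hx => ?_
  have hx' := Finset.HasAntidiagonal.mem_antidiagonal.1 hx
  rw [key x.1 (by omega), Finset.sum_mul]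
  simp_rw [mul_assoc]

/-! ### Divisor sums and second order Gauss congruences. -/

theorem coeff_dilogSum (n : ℕ → ℚ) (k : ℕ) :
    (k : ℚ) ^ 2 * coeff k (dilogSum n) = ∑ d ∈ k.divisors, (d : ℚ) ^ 2 * n d := by
  rcases Nat.eq_zero_or_pos k with rfl | hk
  · simp
  rw [dilogSum, coeff_mk, Finset.mul_sum, Nat.divisors, Finset.sum_filter]
  rw [← Finset.Ico_succ_right_eq_Icc]
  refine Finset.sum_congr rfl fun d hd => ?_
  have hd1 : d ≠ 0 := by have := (Finset.mem_Ico.1 hd).1; omega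
  rw [coeff_subst_X_pow hd1]
  split_ifs with h
  · obtain ⟨m, rfl⟩ := h
    have hm : m ≠ 0 := by rintro rfl; simp at hk
    rw [Nat.mul_div_cancel_left _ (Nat.pos_of_ne_zero hd1)]
    simp only [li2, coeff_mk]
    push_cast
    field_simp
  · simp

theorem constantCoeff_dilogSum (n : ℕ → ℚ) : constantCoeff (dilogSum n) = 0 := by
  rw [← coeff_zero_eq_constantCoeff_apply, dilogSum, coeff_mk]
  simp

/-- A divisor d of k fails to divide k/p exactly when p does not divide k/d. -/
theorem divisors_sdiff_divisors_div {p k d : ℕ} [hp : Fact p.Prime] (hk : k ≠ 0) (hpk : p ∣ k) :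
    d ∈ k.divisors \ (k / p).divisors ↔ d ∣ k ∧ padicValNat p d = padicValNat p k := by
  obtain ⟨m, rfl⟩ := hpk
  have hp0 := hp.out.ne_zero
  have hm : m ≠ 0 := by rintro rfl; simp at hk
  rw [Nat.mul_div_cancel_left _ hp.out.pos, Finset.mem_sdiff, Nat.mem_divisors, Nat.mem_divisors,
    padicValNat.mul hp0 hm, padicValNat.self hp.out.one_lt]
  constructor
  · rintro ⟨⟨hd, -⟩, hd'⟩
    refine ⟨hd, ?_⟩
    obtain ⟨e, he⟩ := hd
    have hpe : ¬ p ∣ e := by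
      rintro ⟨e', rfl⟩
      refine hd' ⟨⟨e', ?_⟩, hm⟩
      refine Nat.eq_of_mul_eq_mul_left hp.out.pos ?_
      rw [he]; ring
    have hd0 : d ≠ 0 := by rintro rfl; simp [hp0, hm] at he
    have he0 : e ≠ 0 := by rintro rfl; simp at hpe
    have := congrArg (padicValNat p) he
    rw [padicValNat.mul hp0 hm, padicValNat.self hp.out.one_lt, padicValNat.mul hd0 he0,
      padicValNat.eq_zero_of_not_dvd hpe] at this
    omega
  · rintro ⟨hd, hv⟩
    refine ⟨⟨hd, hk⟩, ?_⟩
    rintro ⟨⟨e, rfl⟩, -⟩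
    rw [padicValNat.mul (by rintro rfl; simp at hm) (by rintro rfl; simp at hm)] at hv
    omega

theorem sum_divisors_sub_sum_divisors_div {p k : ℕ} (hk : k ≠ 0) (hpk : p ∣ k)
    (f : ℕ → ℤ) : ∑ d ∈ k.divisors, f d - ∑ d ∈ (k / p).divisors, f d =
      ∑ d ∈ k.divisors \ (k / p).divisors, f d := by
  rw [sub_eq_iff_eq_add, Finset.sum_sdiff]
  exact Nat.divisors_subset_of_dvd hk (Nat.div_dvd_of_dvd hpk)

/-- The second order Gauss congruences for `∑ d ∣ k, d ^ 2 * m d`. -/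
theorem pow_dvd_sum_divisors_sub {p k : ℕ} [hp : Fact p.Prime] (hk : k ≠ 0) (hpk : p ∣ k)
    (m : ℕ → ℤ) : (p : ℤ) ^ (2 * padicValNat p k) ∣
      ∑ d ∈ k.divisors, (d : ℤ) ^ 2 * m d - ∑ d ∈ (k / p).divisors, (d : ℤ) ^ 2 * m d := by
  rw [sum_divisors_sub_sum_divisors_div hk hpk]
  refine Finset.dvd_sum fun d hd => Dvd.dvd.mul_right ?_ _
  rw [← ((divisors_sdiff_divisors_div hk hpk).1 hd).2, mul_comm, pow_mul]
  exact pow_dvd_pow_of_dvd (by exact_mod_cast pow_padicValNat_dvd) 2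

/-- The second order Gauss congruences imply that the Möbius inverse of a sequence is divisible
by squares. -/
theorem sq_dvd_of_gauss {f g : ℕ → ℤ} (hfg : ∀ k, 0 < k → ∑ d ∈ k.divisors, f d = g k)
    (hg : ∀ p k : ℕ, p.Prime → k ≠ 0 → p ∣ k →
      (p : ℤ) ^ (2 * padicValNat p k) ∣ g k - g (k / p)) (k : ℕ) (hk : 0 < k) :
    (k : ℤ) ^ 2 ∣ f k := by
  have main : ∀ p : ℕ, p.Prime → ∀ k, 0 < k → (p : ℤ) ^ (2 * padicValNat p k) ∣ f k := by
    intro p hp k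
    have : Fact p.Prime := ⟨hp⟩
    induction k using Nat.strong_induction_on with
    | _ k ih =>
      intro hk
      by_cases hpk : p ∣ k
      -- The difference of the divisor sums runs over d ∣ k with v_p(d) = v_p(k). The induction
      -- hypothesis covers every such d except k itself, which isolates f k.
      · have h1 := hg p k hp hk.ne' hpk
        rw [← hfg k hk, ← hfg (k / p) (Nat.div_pos (Nat.le_of_dvd hk hpk) hp.pos),
          sum_divisors_sub_sum_divisors_div hk.ne' hpk,
          ← Finset.add_sum_erase _ _ ((divisors_sdiff_divisors_div hk.ne' hpk).2
            ⟨dvd_rfl, rfl⟩)] at h1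
        refine (dvd_add_left (Finset.dvd_sum fun d hd => ?_)).1 h1
        obtain ⟨hdk, hd⟩ := Finset.mem_erase.1 hd
        obtain ⟨hdvd, hv⟩ := (divisors_sdiff_divisors_div hk.ne' hpk).1 hd
        rw [← hv]
        exact ih d (lt_of_le_of_ne (Nat.le_of_dvd hk hdvd) hdk) (Nat.pos_of_dvd_of_pos hdvd hk)
      · simp [padicValNat.eq_zero_of_not_dvd hpk]
  rw [← Int.natCast_pow, Int.natCast_dvd, Nat.dvd_iff_prime_pow_dvd_dvd]
  intro p e hp he
  have : Fact p.Prime := ⟨hp⟩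
  have h1 := main p hp k hk
  rw [← Int.natCast_pow, Int.natCast_dvd] at h1
  refine (pow_dvd_pow p ?_).trans h1
  rwa [padicValNat_dvd_iff_le (by positivity), padicValNat.pow] at he

/-! ### Euler products with integer coefficients and a congruence modulo 4. -/

/-- The logarithmic derivative of a unit of `ℤ⟦X⟧`, as a homomorphism. -/
noncomputable def logDelta : ℤ⟦X⟧ˣ →* Multiplicative ℚ⟦X⟧ where
  toFun u := .ofAdd (delta (map (Int.castRingHom ℚ) u) * map (Int.castRingHom ℚ) (u⁻¹ : ℤ⟦X⟧ˣ))
  map_one' := by simp [delta_one]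
  map_mul' u v := by
    have hu : map (Int.castRingHom ℚ) (u : ℤ⟦X⟧) * map (Int.castRingHom ℚ) (u⁻¹ : ℤ⟦X⟧ˣ) = 1 := by
      rw [← map_mul, Units.mul_inv, map_one]
    have hv : map (Int.castRingHom ℚ) (v : ℤ⟦X⟧) * map (Int.castRingHom ℚ) (v⁻¹ : ℤ⟦X⟧ˣ) = 1 := by
      rw [← map_mul, Units.mul_inv, map_one]
    rw [← ofAdd_add]
    congr 1
    simp only [mul_inv, Units.val_mul, map_mul, delta_mul]
    linear_combination
      delta (map (Int.castRingHom ℚ) (v : ℤ⟦X⟧)) * map (Int.castRingHom ℚ) (v⁻¹ : ℤ⟦X⟧ˣ) * hu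
      + delta (map (Int.castRingHom ℚ) (u : ℤ⟦X⟧)) * map (Int.castRingHom ℚ) (u⁻¹ : ℤ⟦X⟧ˣ) * hv

theorem delta_eq_mul_logDelta (u : ℤ⟦X⟧ˣ) : delta (map (Int.castRingHom ℚ) (u : ℤ⟦X⟧)) =
    map (Int.castRingHom ℚ) (u : ℤ⟦X⟧) * (logDelta u).toAdd := by
  have hu : map (Int.castRingHom ℚ) (u : ℤ⟦X⟧) * map (Int.castRingHom ℚ) (u⁻¹ : ℤ⟦X⟧ˣ) = 1 := by
    rw [← map_mul, Units.mul_inv, map_one]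
  change _ = map (Int.castRingHom ℚ) (u : ℤ⟦X⟧) *
    (delta (map (Int.castRingHom ℚ) (u : ℤ⟦X⟧)) * map (Int.castRingHom ℚ) (u⁻¹ : ℤ⟦X⟧ˣ))
  linear_combination -delta (map (Int.castRingHom ℚ) (u : ℤ⟦X⟧)) * hu

/-- The unit `1 - X ^ d` of `ℤ⟦X⟧`, for `d ≠ 0`. -/
noncomputable def oneSubXPow (d : ℕ) (hd : d ≠ 0) : ℤ⟦X⟧ˣ :=
  Units.map (expand d hd : ℤ⟦X⟧ →ₐ[ℤ] ℤ⟦X⟧).toRingHom.toMonoidHom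
    ⟨1 - X, mk 1, by rw [mul_comm, mk_one_mul_one_sub_eq_one], mk_one_mul_one_sub_eq_one ℤ⟩

theorem coe_oneSubXPow (d : ℕ) (hd : d ≠ 0) : (oneSubXPow d hd : ℤ⟦X⟧) = 1 - X ^ d := by
  change expand d hd (1 - X) = _
  simp

theorem coeff_logDelta_oneSubXPow (d : ℕ) (hd : d ≠ 0) (k : ℕ) :
    coeff k (logDelta (oneSubXPow d hd)).toAdd = if k ≠ 0 ∧ d ∣ k then -(d : ℚ) else 0 := by
  have h : (logDelta (oneSubXPow d hd)).toAdd = -((d : ℚ⟦X⟧) * expand d hd (X * mk 1)) := by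
    change delta _ * map (Int.castRingHom ℚ) (expand d hd (mk 1)) = _
    rw [coe_oneSubXPow, map_expand, map_mul, expand_X]
    have h1 : map (Int.castRingHom ℚ) (mk 1) = mk 1 := by ext; simp
    have h2 : delta ((X : ℚ⟦X⟧) ^ d) = X ^ d * ((d : ℚ⟦X⟧) * 1) :=
      delta_pow (by rw [delta_X, mul_one]) d
    rw [h1, sub_eq_add_neg, map_add, map_neg, map_one, map_pow, map_X, delta_add, delta_neg,
      delta_one, h2]
    ring
  rw [h, map_neg, ← map_natCast (C (R := ℚ)), coeff_C_mul, coeff_expand]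
  by_cases hdk : d ∣ k
  · obtain ⟨m, rfl⟩ := hdk
    rw [if_pos (dvd_mul_right d m), Nat.mul_div_cancel_left _ (Nat.pos_of_ne_zero hd)]
    cases m with
    | zero => simp
    | succ m => rw [coeff_succ_X_mul]; simp [hd]
  · simp [hdk]

/-- Units `u` of `ℤ⟦X⟧` such that the even part of `u(z) ^ 2` is congruent to `u(-z ^ 2)`
modulo `4`. -/
noncomputable def evenSquareSubgroup : Subgroup ℤ⟦X⟧ˣ where
  carrier := {u | ∃ B C : ℤ⟦X⟧, (u : ℤ⟦X⟧) ^ 2 =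
    expand 2 two_ne_zero (rescale (-1) (u : ℤ⟦X⟧)) + 2 * (X * expand 2 two_ne_zero B) + 4 * C}
  one_mem' := ⟨0, 0, by simp⟩
  mul_mem' := by
    rintro u v ⟨B, C, hu⟩ ⟨B', C', hv⟩
    refine ⟨rescale (-1) (u : ℤ⟦X⟧) * B' + B * rescale (-1) (v : ℤ⟦X⟧),
      X ^ 2 * expand 2 two_ne_zero B * expand 2 two_ne_zero B' + C * (v : ℤ⟦X⟧) ^ 2 +
      (expand 2 two_ne_zero (rescale (-1) (u : ℤ⟦X⟧)) + 2 * (X * expand 2 two_ne_zero B)) * C', ?_⟩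
    simp only [Units.val_mul, map_mul, map_add, mul_pow]
    rw [hv, hu]
    ring
  inv_mem' := by
    rintro u ⟨B, C, hu⟩
    have h1 : (u : ℤ⟦X⟧) * (u⁻¹ : ℤ⟦X⟧ˣ) = 1 := Units.mul_inv u
    have h2 := congrArg (fun F => expand 2 two_ne_zero (rescale (-1) F)) h1
    simp only [map_mul, map_one] at h2
    refine ⟨-B * rescale (-1) ((u⁻¹ : ℤ⟦X⟧ˣ) : ℤ⟦X⟧) ^ 2, ?_⟩
    simp only [map_mul, map_pow, map_neg]
    set w : ℤ⟦X⟧ := ((u⁻¹ : ℤ⟦X⟧ˣ) : ℤ⟦X⟧)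
    set s := expand 2 two_ne_zero (rescale (-1) w)
    set t := expand 2 two_ne_zero (rescale (-1) (u : ℤ⟦X⟧))
    set b := X * expand 2 two_ne_zero B with hb
    -- Multiply u² = t + 2b + 4C by w²s, where uw = 1 and ts = 1. Then w² ≡ s modulo 2, so replacing
    -- w² by s in the term 2bsw² costs only a multiple of 4 and leaves 2bs², which has odd exponents
    -- only.
    have h3 : w ^ 2 = s - w ^ 2 * s * (2 * b + 4 * C) := by
      linear_combination (-w ^ 2 * s) * hu - w ^ 2 * h2 + s * (u * w + 1) * h1
    refine ⟨b * s * w ^ 2 * s * (b + 2 * C) - w ^ 2 * s * C, ?_⟩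
    linear_combination (1 - 2 * b * s) * h3 + 2 * s ^ 2 * hb

theorem coeff_sq_of_mem_evenSquareSubgroup {u : ℤ⟦X⟧ˣ} (hu : u ∈ evenSquareSubgroup) (k : ℕ) :
    (4 : ℤ) ∣ coeff (2 * k) ((u : ℤ⟦X⟧) ^ 2) - (-1) ^ k * coeff k (u : ℤ⟦X⟧) := by
  obtain ⟨B, D, hu⟩ := hu
  have h0 : coeff (2 * k) (X * expand 2 two_ne_zero B) = 0 := by
    cases k with
    | zero => simp
    | succ k =>
      rw [show 2 * (k + 1) = (2 * k + 1) + 1 by ring, coeff_succ_X_mul, coeff_expand,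
        if_neg (by omega)]
  refine ⟨coeff (2 * k) D, ?_⟩
  have h2 : (2 : ℤ⟦X⟧) = C 2 := (_root_.map_ofNat (C (R := ℤ)) 2).symm
  have h4 : (4 : ℤ⟦X⟧) = C 4 := (_root_.map_ofNat (C (R := ℤ)) 4).symm
  rw [hu, h2, h4, map_add, map_add, coeff_C_mul,
    coeff_C_mul, h0, coeff_expand_mul, coeff_rescale]
  ring

/-- For odd d the factor 1 - X^d itself qualifies. For even d it does not, but its square does, and
the factor d in the exponent makes the exponent even. -/
theorem oneSubXPow_zpow_mem (d : ℕ) (hd : d ≠ 0) (m : ℤ) :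
    oneSubXPow d hd ^ ((d : ℤ) * m) ∈ evenSquareSubgroup := by
  have hX : expand 2 two_ne_zero (rescale (-1) (X : ℤ⟦X⟧)) = -X ^ 2 := by
    rw [rescale_X, map_mul, expand_C, expand_X]; simp
  rcases Nat.even_or_odd d with ⟨e, he⟩ | ⟨e, he⟩
  · have : oneSubXPow d hd ^ 2 ∈ evenSquareSubgroup := by
      refine ⟨0, 2 * (X ^ d) ^ 2 - X ^ d - (X ^ d) ^ 3, ?_⟩
      rw [Units.val_pow_eq_pow_val, coe_oneSubXPow]
      simp only [map_pow, map_sub, map_one, hX, map_zero]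
      have : (-X ^ 2 : ℤ⟦X⟧) ^ d = (X ^ d) ^ 2 := by
        rw [Even.neg_pow ⟨e, he⟩]; ring
      rw [this]
      ring
    have h2 : (d : ℤ) * m = ((2 : ℕ) : ℤ) * (e * m) := by rw [he]; push_cast; ring
    rw [h2, zpow_mul, zpow_natCast]
    exact zpow_mem this _
  · refine zpow_mem ?_ _
    refine ⟨-X ^ e, 0, ?_⟩
    rw [coe_oneSubXPow]
    simp only [map_pow, map_sub, map_one, hX, map_neg, expand_X]
    have : (-X ^ 2 : ℤ⟦X⟧) ^ d = -(X ^ d) ^ 2 := by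
      rw [Odd.neg_pow ⟨e, he⟩]; ring
    rw [this, he]
    ring

/-- The unit `∏ (1 - X ^ d) ^ (-d m_d)`, `1 ≤ d ≤ N`. -/
noncomputable def eulerUnit (m : ℕ → ℤ) (N : ℕ) : ℤ⟦X⟧ˣ :=
  ∏ d ∈ Finset.range N, oneSubXPow (d + 1) d.succ_ne_zero ^ (((d + 1 : ℕ) : ℤ) * -m (d + 1))

theorem eulerUnit_mem (m : ℕ → ℤ) (N : ℕ) : eulerUnit m N ∈ evenSquareSubgroup :=
  prod_mem fun _ _ => oneSubXPow_zpow_mem _ _ _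

theorem constantCoeff_eulerUnit (m : ℕ → ℤ) (N : ℕ) :
    constantCoeff (eulerUnit m N : ℤ⟦X⟧) = 1 := by
  have h : ∀ d : ℕ, Units.map (constantCoeff (R := ℤ)).toMonoidHom
      (oneSubXPow (d + 1) d.succ_ne_zero) = 1 := by
    intro d
    ext
    change constantCoeff (oneSubXPow (d + 1) d.succ_ne_zero : ℤ⟦X⟧) = 1
    simp [coe_oneSubXPow]
  have : Units.map (constantCoeff (R := ℤ)).toMonoidHom (eulerUnit m N) = 1 := by
    rw [eulerUnit, map_prod]
    refine Finset.prod_eq_one fun d _ => ?_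
    rw [map_zpow, h, one_zpow]
  exact congrArg Units.val this

theorem coeff_logDelta_eulerUnit (m : ℕ → ℤ) (N k : ℕ) :
    coeff k (logDelta (eulerUnit m N)).toAdd =
      ∑ d ∈ k.divisors, (d : ℚ) ^ 2 * (if d ≤ N then m d else 0 : ℤ) := by
  rw [eulerUnit, map_prod, toAdd_prod, map_sum]
  simp_rw [map_zpow, toAdd_zpow, map_zsmul, coeff_logDelta_oneSubXPow]
  have h : ∀ d : ℕ, ((((d + 1 : ℕ) : ℤ) * -m (d + 1)) •
      (if k ≠ 0 ∧ d + 1 ∣ k then -((d + 1 : ℕ) : ℚ) else 0)) =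
      if d + 1 ∈ k.divisors then ((d + 1 : ℕ) : ℚ) ^ 2 * (m (d + 1) : ℚ) else 0 := by
    intro d
    simp only [Nat.mem_divisors, and_comm, zsmul_eq_mul]
    split_ifs
    · push_cast; ring
    · simp
  simp_rw [h]
  rw [← Finset.sum_filter]
  have h2 : ∑ d ∈ k.divisors, (d : ℚ) ^ 2 * ((if d ≤ N then m d else 0 : ℤ) : ℚ) =
      ∑ d ∈ k.divisors with d ≤ N, (d : ℚ) ^ 2 * (m d : ℚ) := by
    rw [Finset.sum_filter]
    refine Finset.sum_congr rfl fun d _ => ?_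
    split_ifs <;> simp
  rw [h2]
  refine Finset.sum_bij (fun d _ => d + 1) ?_ ?_ ?_ ?_
  · intro d hd
    simp only [Finset.mem_filter, Finset.mem_range] at hd ⊢
    exact ⟨hd.2, hd.1⟩
  · intro a _ b _ h
    omega
  · intro d hd
    simp only [Finset.mem_filter] at hd
    have := Nat.pos_of_mem_divisors hd.1
    refine ⟨d - 1, ?_, by omega⟩
    simp only [Finset.mem_filter, Finset.mem_range]
    rw [Nat.sub_add_cancel this]
    exact ⟨by omega, hd.1⟩
  · intro d _
    rfl

/-! ### Diagonal coefficients of powers through the Frobenius quotient. -/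

theorem coeff_two_mul_sq (L : ℚ⟦X⟧) (j : ℕ) : coeff (2 * j) (L ^ 2) =
    coeff j L ^ 2 + 2 * ∑ i ∈ Finset.range j, coeff i L * coeff (2 * j - i) L := by
  rw [pow_two, coeff_mul, Finset.Nat.sum_antidiagonal_eq_sum_range_succ_mk,
    show (2 * j).succ = j + (j + 1) by omega, Finset.sum_range_add, Finset.sum_range_succ',
    ← Finset.sum_range_reflect (fun i => coeff (j + (i + 1)) L * coeff _ L)]
  have h : ∀ i ∈ Finset.range j,
      coeff (j + (j - 1 - i + 1)) L * coeff (2 * j - (j + (j - 1 - i + 1))) L =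
      coeff i L * coeff (2 * j - i) L := by
    intro i hi
    have := Finset.mem_range.1 hi
    rw [mul_comm, show 2 * j - (j + (j - 1 - i + 1)) = i by omega,
      show j + (j - 1 - i + 1) = 2 * j - i by omega]
  rw [Finset.sum_congr rfl h, add_zero, show 2 * j - j = j by omega]
  ring

/-- The difference `a k - a (k / p)`, where `a (k / p)` is `0` if `p` does not divide `k`. -/
def gaussDiff (p : ℕ) (a : ℕ → ℤ) (k : ℕ) : ℤ :=
  a k - if p ∣ k then a (k / p) else 0

/-- The series `(1 / p) log (f(z) ^ p / f(z ^ p))`, if `a` is the sequence of coefficients of the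
logarithmic derivative of `f`. -/
noncomputable def frobLog (p : ℕ) (a : ℕ → ℤ) : ℚ⟦X⟧ :=
  mk fun k => (gaussDiff p a k : ℚ) / k

theorem constantCoeff_frobLog (p : ℕ) (a : ℕ → ℤ) : constantCoeff (frobLog p a) = 0 := by
  rw [← coeff_zero_eq_constantCoeff_apply, frobLog, coeff_mk]
  simp

section

variable {f : ℚ⟦X⟧} {a : ℕ → ℤ} {p m : ℕ} [hp : Fact p.Prime]

theorem pow_dvd_gaussDiff
    (ha : ∀ k, k ≠ 0 → p ∣ k → (p : ℤ) ^ (2 * padicValNat p k) ∣ a k - a (k / p))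
    {k : ℕ} (hk : k ≠ 0) : PDvd p (2 * padicValNat p k) (gaussDiff p a k : ℚ) := by
  rw [PDvd.intCast_iff, gaussDiff]
  split_ifs with h
  · exact ha k hk h
  · simp [padicValNat.eq_zero_of_not_dvd h]

/-- Both sides have constant term 1 and the same logarithmic derivative, `p * m` times that of `f`.
-/
theorem pow_eq_expand_mul_exp (h0 : constantCoeff f = 1) (ha0 : a 0 = 0)
    (hf : delta f = f * mk fun k => (a k : ℚ)) :
    f ^ (p * m) = (exp ℚ).subst (((p * m : ℕ) : ℚ⟦X⟧) * frobLog p a) *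
      expand p hp.out.ne_zero (f ^ m) := by
  set A : ℚ⟦X⟧ := mk fun k => (a k : ℚ) with hA
  have hA0 : constantCoeff A = 0 := by
    rw [← coeff_zero_eq_constantCoeff_apply, hA, coeff_mk, ha0, Int.cast_zero]
  have hL : delta (((p * m : ℕ) : ℚ⟦X⟧) * frobLog p a) =
      ((p * m : ℕ) : ℚ⟦X⟧) * (A - expand p hp.out.ne_zero A) := by
    ext k
    rw [coeff_delta, ← map_natCast (C (R := ℚ)), coeff_C_mul, coeff_C_mul, map_sub, coeff_expand,
      frobLog, hA, coeff_mk, coeff_mk, gaussDiff, coeff_mk]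
    rcases Nat.eq_zero_or_pos k with rfl | hk
    · simp
    · have hk0 : (k : ℚ) ≠ 0 := by exact_mod_cast hk.ne'
      field_simp
      push_cast
      split_ifs <;> simp
  have hE0 : constantCoeff (((p * m : ℕ) : ℚ⟦X⟧) * frobLog p a) = 0 := by
    rw [map_mul, constantCoeff_frobLog, mul_zero]
  refine eq_of_delta_eq (A := ((p * m : ℕ) : ℚ⟦X⟧) * A) (delta_pow hf _) ?_ ?_ ?_
  · have h1 : delta (expand p hp.out.ne_zero (f ^ m)) =
        p * (expand p hp.out.ne_zero (f ^ m) * (m * expand p hp.out.ne_zero A)) := by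
      rw [delta_expand, delta_pow hf, map_mul, map_mul, map_natCast]
    rw [delta_mul, delta_exp_subst hE0, hL, h1]
    push_cast
    ring
  · rw [map_pow, h0, one_pow, map_mul, constantCoeff_exp_subst hE0, constantCoeff_expand, map_pow,
      h0, one_pow, one_mul]
  · rw [map_mul, hA0, mul_zero]

theorem coeff_pow_eq_sum (h0 : constantCoeff f = 1) (ha0 : a 0 = 0)
    (hf : delta f = f * mk fun k => (a k : ℚ)) :
    coeff (p * m) (f ^ (p * m)) = ∑ j ∈ Finset.range (p * m + 1),
      ((p * m : ℕ) : ℚ) ^ j / j.factorial *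
        coeff (p * m) (frobLog p a ^ j * expand p hp.out.ne_zero (f ^ m)) := by
  have hE0 : constantCoeff (((p * m : ℕ) : ℚ⟦X⟧) * frobLog p a) = 0 := by
    rw [map_mul, constantCoeff_frobLog, mul_zero]
  conv_lhs => rw [pow_eq_expand_mul_exp h0 ha0 hf]
  rw [coeff_subst_mul _ hE0]
  refine Finset.sum_congr rfl fun j _ => ?_
  rw [mul_pow, ← map_natCast (C (R := ℚ)), ← map_pow, mul_assoc, coeff_C_mul, coeff_exp]
  simp only [Algebra.algebraMap_self, RingHom.id_apply]
  ring

/-- The identity δ(f^m) = m f^m · (δf / f) exhibits the factor m. -/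
theorem PDvd.mul_coeff_pow (hint : ∀ k, PDvd p 0 (coeff k f))
    (hf : delta f = f * mk fun k => (a k : ℚ)) (j : ℕ) :
    PDvd p (padicValNat p m) ((j : ℚ) * coeff j (f ^ m)) := by
  rw [← coeff_delta, delta_pow hf, mul_left_comm, ← map_natCast (C (R := ℚ)), coeff_C_mul]
  have h1 := PDvd.powerSeries_mul (PDvd.powerSeries_pow hint m)
    (G := mk fun k => (a k : ℚ)) (by intro k; rw [coeff_mk]; exact .intCast _) j
  exact (PDvd.natCast le_rfl).mul_left h1

theorem PDvd.coeff_frobLog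
    (ha : ∀ k, k ≠ 0 → p ∣ k → (p : ℤ) ^ (2 * padicValNat p k) ∣ a k - a (k / p)) (k : ℕ) :
    PDvd p 0 (coeff k (frobLog p a)) := by
  rw [frobLog, coeff_mk]
  rcases eq_or_ne k 0 with rfl | hk
  · simpa using PDvd.zero
  · exact (pow_dvd_gaussDiff ha hk).div_natCast hk (by omega)

/-- Each contribution is [z^(pi)] L · [z^j] f^m with i + j = m. Moving a factor i from the first
coefficient to the second makes them divisible by p and by p^(v_p(m)) respectively. -/
theorem PDvd.coeff_frobLog_mul (hm : m ≠ 0) (hint : ∀ k, PDvd p 0 (coeff k f))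
    (hf : delta f = f * mk fun k => (a k : ℚ))
    (ha : ∀ k, k ≠ 0 → p ∣ k → (p : ℤ) ^ (2 * padicValNat p k) ∣ a k - a (k / p)) :
    PDvd p (padicValNat p (p * m))
      (coeff (p * m) (frobLog p a * expand p hp.out.ne_zero (f ^ m))) := by
  rw [coeff_mul]
  refine PDvd.sum fun x hx => ?_
  have hx := Finset.HasAntidiagonal.mem_antidiagonal.1 hx
  rw [coeff_expand]
  split_ifs with h
  swap
  · rw [mul_zero]; exact PDvd.zero
  have h1 : p ∣ x.1 := (Nat.dvd_add_left h).1 (hx ▸ dvd_mul_right p m)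
  obtain ⟨i, hi⟩ := h1
  obtain ⟨j, hj⟩ := h
  have hp0 := hp.out.ne_zero
  have hij : i + j = m := by
    refine Nat.eq_of_mul_eq_mul_left hp.out.pos ?_
    rw [← hx, hi, hj]; ring
  rw [hi, hj, Nat.mul_div_cancel_left _ hp.out.pos, padicValNat.mul hp0 hm,
    padicValNat.self hp.out.one_lt, frobLog, coeff_mk]
  rcases eq_or_ne i 0 with rfl | hi0
  · simpa using PDvd.zero
  -- Here i = m - j: both m and j times the coefficient are divisible by p^(v_p(m)).
  have h2 : PDvd p (padicValNat p m) ((i : ℚ) * coeff j (f ^ m)) := by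
    have h3 := (PDvd.natCast (p := p) (k := m) le_rfl).mul_left (PDvd.powerSeries_pow hint m j)
    have h4 := PDvd.mul_coeff_pow (m := m) hint hf j
    have := h3.sub h4
    rw [← sub_mul] at this
    rwa [← hij, Nat.cast_add, add_sub_cancel_right, hij] at this
  have hpi : p * i ≠ 0 := mul_ne_zero hp0 hi0
  -- The valuation count is 2(v_p(i) + 1) - (2 v_p(i) + 1) = 1.
  have h5 : PDvd p 1 ((gaussDiff p a (p * i) : ℚ) / ((p * i * i : ℕ) : ℚ)) := by
    refine (pow_dvd_gaussDiff ha hpi).div_natCast (mul_ne_zero hpi hi0) ?_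
    rw [padicValNat.mul hpi hi0, padicValNat.mul hp0 hi0, padicValNat.self hp.out.one_lt]
    omega
  have h6 := h5.mul h2
  have hi' : (i : ℚ) ≠ 0 := by exact_mod_cast hi0
  have hp' : (p : ℚ) ≠ 0 := by exact_mod_cast hp0
  convert h6 using 1
  push_cast
  field_simp

/-- Modulo 2 the cross terms of L² drop out, leaving ([z^i] L)² [z^j] f^m with i + j = m. Here i
[z^j] f^m is even because m is, and [z^i] L / i is still 2-integral. -/
theorem PDvd.two_coeff_frobLog_sq_mul {m : ℕ} (hm : m ≠ 0) (hm2 : 2 ∣ m)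
    (hint : ∀ k, PDvd 2 0 (coeff k f)) (hf : delta f = f * mk fun k => (a k : ℚ))
    (ha : ∀ k, k ≠ 0 → 2 ∣ k → (2 : ℤ) ^ (2 * padicValNat 2 k) ∣ a k - a (k / 2)) :
    PDvd 2 1 (coeff (2 * m) (frobLog 2 a ^ 2 * expand 2 two_ne_zero (f ^ m))) := by
  have hL := PDvd.coeff_frobLog (p := 2) (a := a) (by exact_mod_cast ha)
  rw [coeff_mul]
  refine PDvd.sum fun x hx => ?_
  have hx := Finset.HasAntidiagonal.mem_antidiagonal.1 hx
  rw [coeff_expand]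
  split_ifs with h
  swap
  · rw [mul_zero]; exact PDvd.zero
  have h1 : 2 ∣ x.1 := (Nat.dvd_add_left h).1 (hx ▸ dvd_mul_right 2 m)
  obtain ⟨i, hi⟩ := h1
  obtain ⟨j, hj⟩ := h
  have hij : i + j = m := by omega
  have hv : 1 ≤ padicValNat 2 m := one_le_padicValNat_of_dvd hm hm2
  rw [hi, hj, Nat.mul_div_cancel_left _ two_pos, coeff_two_mul_sq, add_mul]
  have hcoef := PDvd.powerSeries_pow hint m j
  have h2 : PDvd 2 1 (coeff i (frobLog 2 a) * coeff j (f ^ m)) := by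
    rw [frobLog, coeff_mk]
    rcases eq_or_ne i 0 with rfl | hi0
    · simpa using PDvd.zero
    have h3 : PDvd 2 1 ((i : ℚ) * coeff j (f ^ m)) := by
      have h3 := (PDvd.natCast (p := 2) (k := m) hv).mul_left hcoef
      have h4 := (PDvd.mul_coeff_pow (m := m) hint hf j).mono hv
      have := h3.sub h4
      rw [← sub_mul] at this
      rwa [← hij, Nat.cast_add, add_sub_cancel_right, hij] at this
    have h5 : PDvd 2 0 ((gaussDiff 2 a i : ℚ) / ((i * i : ℕ) : ℚ)) := by
      refine (pow_dvd_gaussDiff (by exact_mod_cast ha) hi0).div_natCast (mul_ne_zero hi0 hi0) ?_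
      rw [padicValNat.mul hi0 hi0]
      omega
    have h6 := h5.mul_right h3
    have hi' : (i : ℚ) ≠ 0 := by exact_mod_cast hi0
    convert h6 using 1
    push_cast
    field_simp
  refine PDvd.add ?_ ?_
  · rw [pow_two, mul_assoc]
    exact (hL i).mul_right h2
  · have h7 : PDvd 2 1 (2 : ℚ) := by
      have := PDvd.natCast (p := 2) (k := 2) (r := 1) (by simp)
      exact_mod_cast this
    rw [mul_assoc]
    exact h7.mul_left ((PDvd.sum fun k _ => (hL k).mul_left (hL _)).mul_left hcoef)

/-- The congruence `[z ^ n] f ^ n ≡ [z ^ (n / p)] f ^ (n / p)` modulo `p ^ (2 v_p(n))`, with an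
exception at `p = 2`, for series whose logarithmic derivative satisfies second order Gauss
congruences. -/
theorem PDvd.coeff_pow_sub_coeff_pow (hm : m ≠ 0) (h0 : constantCoeff f = 1) (ha0 : a 0 = 0)
    (hint : ∀ k, PDvd p 0 (coeff k f)) (hf : delta f = f * mk fun k => (a k : ℚ))
    (ha : ∀ k, k ≠ 0 → p ∣ k → (p : ℤ) ^ (2 * padicValNat p k) ∣ a k - a (k / p))
    (hpm : p ≠ 2 ∨ 2 ∣ m) :
    PDvd p (2 * padicValNat p (p * m))
      (coeff (p * m) (f ^ (p * m)) - coeff m (f ^ m)) := by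
  have hp0 := hp.out.ne_zero
  have hn : p * m ≠ 0 := mul_ne_zero hp0 hm
  have hn2 : 1 < p * m := lt_of_lt_of_le hp.out.one_lt (Nat.le_mul_of_pos_right _ (by omega))
  obtain ⟨k, hk⟩ := Nat.exists_eq_add_of_lt hn2
  have hexp : ∀ i, PDvd p 0 (coeff i (expand p hp0 (f ^ m))) := by
    intro i
    rw [coeff_expand]
    split_ifs
    · exact PDvd.powerSeries_pow hint m _
    · exact PDvd.zero
  have hlarge : ∀ j, 2 ≤ j → (p ≠ 2 ∨ (3 ≤ j ∧ 2 ≤ padicValNat p (p * m))) →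
      PDvd p (2 * padicValNat p (p * m)) (((p * m : ℕ) : ℚ) ^ j / j.factorial *
        coeff (p * m) (frobLog p a ^ j * expand p hp0 (f ^ m))) := fun j hj h =>
    (PDvd.pow_div_factorial (dvd_mul_right p m) hn hj h).mul_left
      (PDvd.powerSeries_mul (PDvd.powerSeries_pow (PDvd.coeff_frobLog ha) j) hexp _)
  have hval : p = 2 → 2 ≤ padicValNat p (p * m) := by
    rintro rfl
    have := one_le_padicValNat_of_dvd hm (hpm.resolve_left (by simp))
    rw [padicValNat.mul hp0 hm, padicValNat.self hp.out.one_lt]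
    omega
  rw [coeff_pow_eq_sum h0 ha0 hf, Finset.sum_range_succ', Finset.range_eq_Ico,
    Finset.sum_eq_sum_Ico_succ_bot (by omega)]
  simp only [pow_zero, Nat.factorial_zero, Nat.cast_one, div_one, one_mul, zero_add, pow_one,
    Nat.factorial_one]
  rw [coeff_expand_mul, add_sub_cancel_right]
  refine PDvd.add ?_ (PDvd.sum fun j hj => ?_)
  · rw [two_mul]
    exact (PDvd.natCast le_rfl).mul (PDvd.coeff_frobLog_mul hm hint hf ha)
  · have hj1 := (Finset.mem_Ico.1 hj).1
    by_cases h2 : p = 2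
    · rcases Nat.eq_or_lt_of_le hj1 with rfl | hj2
      -- For p = j = 2 the factor n²/2 misses one power of 2; the coefficient it multiplies is even.
      · subst h2
        have h3 := PDvd.two_coeff_frobLog_sq_mul hm (hpm.resolve_left (by simp)) hint hf
          (by exact_mod_cast ha)
        have h4 := (PDvd.natCast (p := 2) (k := (2 * m) ^ 2) (r := 2 * padicValNat 2 (2 * m))
          (by rw [padicValNat.pow _])).div_natCast (r := 2 * padicValNat 2 (2 * m) - 1)
          (Nat.factorial_ne_zero 2) (by
            have := hval rfl
            rw [Nat.factorial_two, padicValNat.self (by norm_num)]; omega)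
        have h5 := (h4.mul h3).mono (s := 2 * padicValNat 2 (2 * m)) (by omega)
        exact_mod_cast h5
      · exact hlarge (j + 1) (by omega) (.inr ⟨by omega, hval h2⟩)
    · exact hlarge (j + 1) (by omega) (.inl h2)

end

/-- The signed diagonal coefficients `(-1) ^ k [z ^ k] u ^ k`. -/
noncomputable def signedDiag (u : ℤ⟦X⟧) (k : ℕ) : ℤ :=
  (-1) ^ k * coeff k (u ^ k)

theorem pow_dvd_signedDiag_sub {u : ℤ⟦X⟧ˣ} {a : ℕ → ℤ} {p k : ℕ} [hp : Fact p.Prime]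
    (hk : k ≠ 0) (hpk : p ∣ k) (h0 : constantCoeff (u : ℤ⟦X⟧) = 1) (hu : u ∈ evenSquareSubgroup)
    (ha0 : a 0 = 0) (hua : (logDelta u).toAdd = mk fun k => (a k : ℚ))
    (ha : ∀ k, k ≠ 0 → p ∣ k → (p : ℤ) ^ (2 * padicValNat p k) ∣ a k - a (k / p)) :
    (p : ℤ) ^ (2 * padicValNat p k) ∣ signedDiag u k - signedDiag u (k / p) := by
  obtain ⟨m, rfl⟩ := hpk
  have hm : m ≠ 0 := by rintro rfl; simp at hk
  rw [Nat.mul_div_cancel_left _ hp.out.pos]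
  by_cases hcase : p = 2 ∧ ¬ 2 ∣ m
  -- Now v_2(2m) = 1, so the modulus is 4. Membership of u^m in the subgroup gives the congruence,
  -- with the sign (-1)^m built in.
  · obtain ⟨rfl, h2⟩ := hcase
    rw [padicValNat.mul two_ne_zero hm, padicValNat.self (by norm_num),
      padicValNat.eq_zero_of_not_dvd h2]
    have := coeff_sq_of_mem_evenSquareSubgroup (pow_mem hu m) m
    rw [Units.val_pow_eq_pow_val, ← pow_mul, mul_comm m 2] at this
    simpa [signedDiag, pow_mul] using this
  · have hpm : p ≠ 2 ∨ 2 ∣ m := by tauto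
    have hsign : (-1 : ℤ) ^ (p * m) = (-1) ^ m := by
      by_cases h2 : p = 2
      · have := hpm.resolve_left (by simpa using h2)
        rw [Even.neg_one_pow (even_iff_two_dvd.2 this),
          Even.neg_one_pow (even_iff_two_dvd.2 (this.mul_left p))]
      · rw [pow_mul, (hp.out.odd_of_ne_two h2).neg_one_pow]
    have hdelta := delta_eq_mul_logDelta u
    rw [hua] at hdelta
    have := PDvd.coeff_pow_sub_coeff_pow (p := p) hm (f := map (Int.castRingHom ℚ) (u : ℤ⟦X⟧))
      (by rw [← coeff_zero_eq_constantCoeff_apply, coeff_map, coeff_zero_eq_constantCoeff_apply,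
        h0]; simp) ha0 (by intro i; rw [coeff_map]; exact .intCast _) hdelta ha hpm
    rw [← map_pow, ← map_pow, coeff_map, coeff_map] at this
    simp only [eq_intCast] at this
    rw [← Int.cast_sub, PDvd.intCast_iff] at this
    rw [signedDiag, signedDiag, hsign, ← mul_sub]
    exact this.mul_left _

/-! ### Lagrange inversion. -/

/-- Lagrange inversion: if `w = -z Y(z)` has the inverse `z = -w Y'(w)` and `φ = 1 / Y`, then the
coefficient of `w ^ n` in `w d/dw log Y'` is `(-1) ^ n [z ^ n] φ ^ n`. -/
theorem coeff_delta_logOf_of_inverse {Y φ η Y' : ℚ⟦X⟧} (hY : Y * φ = 1)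
    (hφ : delta φ = φ * η) (hη : constantCoeff η = 0)
    (hY' : constantCoeff Y' = 1) (hinv : (-(X * Y')).subst (-(X * Y)) = (X : ℚ⟦X⟧))
    {n : ℕ} (hn : n ≠ 0) :
    coeff n (delta (logOf Y')) = (-1) ^ n * coeff n (φ ^ n) := by
  set F : ℚ⟦X⟧ := -(X * Y) with hF
  have hF0 : constantCoeff F = 0 := by simp [hF]
  have hs : HasSubst F := .of_constantCoeff_zero' hF0
  have hφ0 : φ ≠ 0 := by rintro rfl; simp at hY
  have hY0 : Y ≠ 0 := by rintro rfl; simp at hY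
  have hFne : F ≠ 0 := neg_ne_zero.2 (mul_ne_zero X_ne_zero hY0)
  have h1 : Y'.subst F = φ := by
    have h2 : -(F * Y'.subst F) = X := by
      rw [← hinv, ← coe_substAlgHom hs, map_neg, map_mul, coe_substAlgHom hs, subst_X hs]
    have h3 : Y * Y'.subst F = 1 := by
      refine mul_left_cancel₀ (X_ne_zero (R := ℚ)) ?_
      rw [mul_one]
      nth_rw 2 [← h2]
      rw [hF]; ring
    linear_combination φ * h3 - Y'.subst F * hY
  have hδF : delta F = F * (1 - η) := by
    have h2 := congrArg delta hY
    rw [delta_mul, delta_one, hφ] at h2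
    rw [hF, delta_neg, delta_mul, delta_X]
    linear_combination (-X * Y) * h2 + (X * Y * η + X * delta Y) * hY
  have h4 : (delta Y').subst F * (1 - η) = φ * η := by
    have h5 := delta_subst (F := Y') hF0
    rw [h1, hφ, hδF] at h5
    refine mul_right_cancel₀ hFne ?_
    linear_combination -h5
  have h6 : ((1 + delta (logOf Y')).subst F) * (1 - η) = 1 := by
    have h7 : (delta Y').subst F = (delta (logOf Y')).subst F * φ := by
      rw [← delta_logOf hY', subst_mul hs, h1]
    have h8 : (1 + delta (logOf Y')).subst F = 1 + (delta (logOf Y')).subst F := by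
      rw [← coe_substAlgHom hs, map_add, map_one]
    rw [h8]
    rw [h7] at h4
    linear_combination Y * h4 - ((delta (logOf Y')).subst F * (1 - η) - η) * hY
  -- The residue argument: j [z^j] φ^j = [z^j] δ(φ^j) = j [z^j] φ^j η.
  have hlow : ∀ j, j ≠ 0 → coeff j (φ ^ j * (1 - η)) = 0 := by
    intro j hj
    have hj0 : (j : ℚ) ≠ 0 := by exact_mod_cast hj
    have h9 := coeff_delta (φ ^ j) j
    rw [delta_pow hφ, mul_left_comm, ← map_natCast (C (R := ℚ)), coeff_C_mul] at h9
    rw [mul_sub, mul_one, map_sub, ← mul_left_cancel₀ hj0 h9, sub_self]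
  -- As F = -z/φ, the product F^i φ^n equals (-z)^i φ^(n-i), so only i = n survives when φ^n is
  -- expanded in powers of F.
  have hterm : ∀ i ≤ n, coeff n (F ^ i * ((1 - η) * φ ^ n)) =
      if i = n then (-1) ^ n else 0 := by
    intro i hi
    obtain ⟨j, rfl⟩ := Nat.exists_eq_add_of_le hi
    have h10 : F ^ i * ((1 - η) * φ ^ (i + j)) =
        C ((-1) ^ i) * (X ^ i * (φ ^ j * (1 - η))) := by
      have h11 : (Y * φ) ^ i = 1 := by rw [hY, one_pow]
      rw [mul_pow] at h11
      rw [hF, neg_pow, mul_pow, pow_add, map_pow, map_neg, map_one]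
      linear_combination ((-1) ^ i * X ^ i * (1 - η) * φ ^ j) * h11
    rw [h10, coeff_C_mul, add_comm i j, coeff_X_pow_mul]
    rcases eq_or_ne j 0 with rfl | hj
    · simp [hη]
    · rw [hlow j hj, if_neg (by omega), mul_zero]
  have hsum := coeff_subst_mul (F := 1 + delta (logOf Y')) ((1 - η) * φ ^ n) hF0 n
  rw [← mul_assoc, h6, one_mul, Finset.sum_eq_single n] at hsum
  · rw [hterm n le_rfl, if_pos rfl, map_add, coeff_one, if_neg hn, zero_add] at hsum
    have h12 : ((-1 : ℚ) ^ n) * (-1) ^ n = 1 := by rw [← mul_pow]; simp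
    rw [hsum]
    linear_combination (-coeff n (delta (logOf Y'))) * h12
  · intro i hi hin
    rw [hterm i (by have := Finset.mem_range.1 hi; omega), if_neg hin, mul_zero]
  · intro h
    simp at h

/-! ### Existence and uniqueness of the framed image. -/

theorem constantCoeff_delta (F : ℚ⟦X⟧) : constantCoeff (delta F) = 0 := by
  simp [delta]

theorem expNegDelta_mul_exp (W : ℚ⟦X⟧) : expNegDelta W * (exp ℚ).subst (delta W) = 1 := by
  have h1 : constantCoeff (-delta W) = 0 := by rw [map_neg, constantCoeff_delta, neg_zero]
  have h2 := constantCoeff_delta W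
  refine eq_of_delta_eq (A := 0) ?_ (by rw [delta_one, mul_zero]) ?_ (map_zero _)
  · rw [expNegDelta, delta_mul, delta_exp_subst h1, delta_exp_subst h2, delta_neg]
    ring
  · rw [expNegDelta, map_mul, constantCoeff_exp_subst h1, constantCoeff_exp_subst h2, map_one,
      mul_one]

theorem exists_areCompInverse {Y : ℚ⟦X⟧} (hY : constantCoeff Y = 1) :
    ∃ Y' : ℚ⟦X⟧, constantCoeff Y' = 1 ∧ AreCompInverse (-(X * Y)) (-(X * Y')) := by
  have h1 : coeff 1 (-(X * Y)) = -1 := by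
    rw [map_neg, coeff_succ_X_mul 0 Y, coeff_zero_eq_constantCoeff_apply, hY]
  have hu : IsUnit (coeff 1 (-(X * Y))) := by rw [h1]; exact isUnit_one.neg
  have h0 : constantCoeff (-(X * Y)) = 0 := by simp
  obtain ⟨H, hH⟩ := X_dvd_iff.2 (constantCoeff_substInvOfIsUnit (P := -(X * Y)) (hP' := hu))
  refine ⟨-H, ?_, h0, by simp, ?_, ?_⟩
  · have h2 := coeff_one_substInvOfIsUnit (P := -(X * Y)) (hP' := hu)
    rw [hH, coeff_succ_X_mul 0 H, coeff_zero_eq_constantCoeff_apply] at h2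
    rw [map_neg, h2]
    simp [h1]
  · rw [mul_neg, neg_neg, ← hH]
    exact subst_substInvOfIsUnit_right _ h0 hu
  · rw [mul_neg, neg_neg, ← hH]
    exact subst_substInvOfIsUnit_left _ h0 hu

theorem AreCompInverse.unique {F G H : ℚ⟦X⟧} (hG : AreCompInverse F G)
    (hH : AreCompInverse F H) : G = H := by
  obtain ⟨hF0, hG0, -, hGF⟩ := hG
  obtain ⟨-, hH0, hFH, -⟩ := hH
  have sF : HasSubst F := .of_constantCoeff_zero' hF0
  have sH : HasSubst H := .of_constantCoeff_zero' hH0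
  have h := subst_comp_subst_apply sF sH G
  rw [hGF, hFH, X_subst, subst_X sH] at h
  exact h.symm

theorem existsUnique_isFramedImage (W : ℚ⟦X⟧) : ∃! W' : ℚ⟦X⟧, IsFramedImage W W' := by
  have h1 : constantCoeff (-delta W) = 0 := by rw [map_neg, constantCoeff_delta, neg_zero]
  obtain ⟨Y', hY', hinv⟩ := exists_areCompInverse (Y := expNegDelta W) (constantCoeff_exp_subst h1)
  refine ⟨mk fun k => -coeff k (logOf Y') / k, ⟨Y', hY', hinv, ?_, ?_⟩, ?_⟩
  · rw [← coeff_zero_eq_constantCoeff_apply, coeff_mk]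
    simp
  · ext k
    rw [coeff_delta, coeff_mk, map_neg]
    rcases eq_or_ne k 0 with rfl | hk
    · rw [coeff_zero_eq_constantCoeff_apply, constantCoeff_logOf hY']
      simp
    · have : (k : ℚ) ≠ 0 := by exact_mod_cast hk
      field_simp
  · rintro W₂ ⟨Y₂, -, hinv₂, h0, hδ⟩
    have : Y₂ = Y' := mul_left_cancel₀ (X_ne_zero (R := ℚ)) (neg_injective (hinv₂.unique hinv))
    subst this
    refine delta_injective ?_ ?_
    · rw [hδ]
      ext k
      rw [coeff_delta, coeff_mk, map_neg]
      rcases eq_or_ne k 0 with rfl | hk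
      · rw [coeff_zero_eq_constantCoeff_apply, constantCoeff_logOf hY']
        simp
      · have : (k : ℚ) ≠ 0 := by exact_mod_cast hk
        field_simp
    · rw [h0, ← coeff_zero_eq_constantCoeff_apply, coeff_mk]
      simp

/-! ### Gauss congruences and integrality for the framed image. -/

theorem IsFramedImage.sq_mul_coeff {W W' : ℚ⟦X⟧} (h : IsFramedImage W W') {k : ℕ} (hk : k ≠ 0) :
    (k : ℚ) ^ 2 * coeff k W' =
      -((-1) ^ k * coeff k ((exp ℚ).subst (delta W) ^ k)) := by
  obtain ⟨Y', hY', ⟨-, -, -, hinv⟩, -, hδ⟩ := h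
  have h2 := constantCoeff_delta W
  rw [← coeff_delta_logOf_of_inverse (expNegDelta_mul_exp W) (delta_exp_subst h2)
    (constantCoeff_delta _) hY' hinv hk, coeff_delta, ← mul_neg, ← map_neg, ← hδ, coeff_delta]
  ring

/-- Up to order `N`, the series `exp (δ W)` of `W = ∑ m_d Li₂(z ^ d)` is the product
`∏ (1 - z ^ d) ^ (-d m_d)`, `1 ≤ d ≤ N`. -/
theorem coeff_exp_delta_dilogSum_pow (m : ℕ → ℤ) {N k : ℕ} (hk : k ≤ N) (j : ℕ) :
    coeff k ((exp ℚ).subst (delta (dilogSum fun d => (m d : ℚ))) ^ j) =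
      ((coeff k ((eulerUnit m N : ℤ⟦X⟧) ^ j) : ℤ) : ℚ) := by
  set W := dilogSum fun d => (m d : ℚ)
  have h2 := constantCoeff_delta W
  have hc : ∀ i, coeff i (delta (delta W)) = ∑ d ∈ i.divisors, (d : ℚ) ^ 2 * m d := by
    intro i
    rw [coeff_delta, coeff_delta, ← coeff_dilogSum]
    ring
  have hsub : ∀ i ≤ N, coeff i (delta (delta W)) =
      coeff i (logDelta (eulerUnit m N)).toAdd := by
    intro i hi
    rw [hc, coeff_logDelta_eulerUnit]
    refine Finset.sum_congr rfl fun d hd => ?_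
    rw [if_pos ((Nat.divisor_le hd).trans hi)]
  have key := coeff_eq_of_delta_eq (N := N) (delta_pow (delta_exp_subst h2) j)
    (delta_pow (delta_eq_mul_logDelta (eulerUnit m N)) j) ?_ ?_ ?_ ?_ k hk
  · rw [key, ← map_pow, coeff_map, eq_intCast]
  · rw [map_pow, map_pow, constantCoeff_exp_subst h2, ← coeff_zero_eq_constantCoeff_apply,
      coeff_map, coeff_zero_eq_constantCoeff_apply, constantCoeff_eulerUnit, map_one]
  · rw [map_mul, constantCoeff_delta, mul_zero]
  · rw [map_mul, ← coeff_zero_eq_constantCoeff_apply (logDelta _).toAdd,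
      ← hsub 0 (Nat.zero_le _), coeff_zero_eq_constantCoeff_apply, constantCoeff_delta, mul_zero]
  · intro i hi
    rw [← map_natCast (C (R := ℚ)), coeff_C_mul, coeff_C_mul, hsub i hi]

theorem exists_gauss_of_isFramedImage {W W' : ℚ⟦X⟧} (hW : IsTwoFunction W)
    (h : IsFramedImage W W') : ∃ g : ℕ → ℤ,
      (∀ k : ℕ, k ≠ 0 → (k : ℚ) ^ 2 * coeff k W' = g k) ∧
      ∀ p k : ℕ, p.Prime → k ≠ 0 → p ∣ k →
        (p : ℤ) ^ (2 * padicValNat p k) ∣ g k - g (k / p) := by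
  obtain ⟨m, rfl⟩ := hW
  -- The values at k and k/p must come from one and the same unit, so the truncation order is raised
  -- from k/p to k.
  have hdiag : ∀ {N k : ℕ}, k ≤ N →
      signedDiag (eulerUnit m N) k = signedDiag (eulerUnit m k) k := by
    intro N k hk
    have := (coeff_exp_delta_dilogSum_pow m hk k).symm.trans
      (coeff_exp_delta_dilogSum_pow m le_rfl k)
    rw [signedDiag, signedDiag, Int.cast_injective this]
  refine ⟨fun k => -signedDiag (eulerUnit m k) k, fun k hk => ?_, fun p k hp hk hpk => ?_⟩
  · rw [h.sq_mul_coeff hk, coeff_exp_delta_dilogSum_pow m le_rfl]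
    simp [signedDiag]
  · have : Fact p.Prime := ⟨hp⟩
    beta_reduce
    rw [← hdiag (Nat.div_le_self k p), neg_sub_neg, dvd_sub_comm]
    refine pow_dvd_signedDiag_sub
      (a := fun i => ∑ d ∈ i.divisors, (d : ℤ) ^ 2 * if d ≤ k then m d else 0) hk hpk
      (constantCoeff_eulerUnit m k) (eulerUnit_mem m k) (by simp) ?_
      (fun i hi hpi => pow_dvd_sum_divisors_sub hi hpi _)
    ext i
    rw [coeff_logDelta_eulerUnit, coeff_mk]
    push_cast
    rfl

/-- A power series without constant term is a sum of dilogarithms exactly when its coefficients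
are given by the corresponding divisor sums. -/
theorem eq_dilogSum_iff {W : ℚ⟦X⟧} (h0 : constantCoeff W = 0) (n : ℕ → ℚ) :
    W = dilogSum n ↔ ∀ k : ℕ, 0 < k →
      ∑ d ∈ k.divisors, (d : ℚ) ^ 2 * n d = (k : ℚ) ^ 2 * coeff k W := by
  constructor
  · rintro rfl k -
    rw [coeff_dilogSum]
  · intro h
    ext k
    rcases Nat.eq_zero_or_pos k with rfl | hk
    · rw [coeff_zero_eq_constantCoeff_apply, coeff_zero_eq_constantCoeff_apply, h0,
        constantCoeff_dilogSum]
    · have hk0 : (k : ℚ) ^ 2 ≠ 0 := by positivity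
      exact mul_left_cancel₀ hk0 (by rw [← h k hk, coeff_dilogSum])

/-- A series whose coefficients satisfy the second order Gauss congruences is a 2-function, and
its expansion in dilogarithms is unique. -/
theorem exists_dilogSum_of_gauss {W : ℚ⟦X⟧} (h0 : constantCoeff W = 0) {g : ℕ → ℤ}
    (hg : ∀ k : ℕ, k ≠ 0 → (k : ℚ) ^ 2 * coeff k W = g k)
    (hgauss : ∀ p k : ℕ, p.Prime → k ≠ 0 → p ∣ k →
      (p : ℤ) ^ (2 * padicValNat p k) ∣ g k - g (k / p)) :
    ∃ n : ℕ → ℤ, (W = dilogSum fun d => (n d : ℚ)) ∧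
      ∀ n' : ℕ → ℚ, W = dilogSum n' → ∀ d : ℕ, 1 ≤ d → n' d = n d := by
  obtain ⟨f, hf⟩ : ∃ f : ℕ → ℤ, ∀ k, 0 < k → ∑ d ∈ k.divisors, f d = g k :=
    ⟨_, ArithmeticFunction.sum_eq_iff_sum_mul_moebius_eq.2 fun _ _ => rfl⟩
  choose! n hn using sq_dvd_of_gauss hf hgauss
  refine ⟨n, ?_, fun n' hn' d hd => ?_⟩
  · rw [eq_dilogSum_iff h0]
    intro k hk
    rw [hg k hk.ne', ← hf k hk]
    push_cast
    refine Finset.sum_congr rfl fun d hd => ?_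
    rw [hn d (Nat.pos_of_mem_divisors hd)]
    push_cast
    rfl
  · rw [eq_dilogSum_iff h0] at hn'
    have h1 := ArithmeticFunction.sum_eq_iff_sum_mul_moebius_eq.1 hn' d hd
    have hf' : ∀ k : ℕ, 0 < k → ∑ d ∈ k.divisors, (f d : ℚ) = (k : ℚ) ^ 2 * coeff k W := by
      intro k hk
      rw [hg k hk.ne', ← hf k hk]
      push_cast
      rfl
    have h2 := ArithmeticFunction.sum_eq_iff_sum_mul_moebius_eq.1 hf' d hd
    have h3 := h1.symm.trans h2
    rw [hn d hd] at h3
    have hd0 : (d : ℚ) ^ 2 ≠ 0 := by positivity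
    refine mul_left_cancel₀ hd0 (h3.trans ?_)
    push_cast
    rfl

end Framing

theorem theorem1 (W : PowerSeries ℚ) (hW : Framing.IsTwoFunction W) :
    (∃! W' : PowerSeries ℚ, Framing.IsFramedImage W W') ∧
    ∀ W' : PowerSeries ℚ, Framing.IsFramedImage W W' →
      Framing.IsTwoFunction W' ∧
      ∀ n' : ℕ → ℚ, W' = Framing.dilogSum n' → ∀ d : ℕ, 1 ≤ d → ∃ m : ℤ, n' d = (m : ℚ) := by
  refine ⟨Framing.existsUnique_isFramedImage W, fun W' hW' => ?_⟩
  obtain ⟨g, hg, hgauss⟩ := Framing.exists_gauss_of_isFramedImage hW hW'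
  obtain ⟨-, -, -, h0, -⟩ := id hW'
  obtain ⟨n, hn, huniq⟩ := Framing.exists_dilogSum_of_gauss h0 hg hgauss
  exact ⟨⟨n, hn⟩, fun n' hn' d hd => ⟨n d, huniq n' hn' d hd⟩⟩
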